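/- For $n\ge 2$ let $R_n$ be the hexagonal cylinder chain: the graph with the $4n$ vertices $p_k,u_k,q_k,v_k$, indices $k$ being read modulo $n$ (so $p_0=p_n$, etc.), and the $5n$ edges $p_ku_k,\ u_kp_{k+1},\ q_kv_k,\ v_kq_{k+1},\ p_kq_k$; thus the hexagons $p_{k}u_{k}p_{k+1}q_{k+1}v_{k}q_{k}$ form a closed ring, consecutive ones sharing an edge $p_kq_k$. Let $r_{R_n}(x,y)$ be the resistance distance between the vertices $x$ and $y$ of $R_n$, i.e. the potential difference between $x$ and $y$ when every edge is a unit resistor and a unit current enters at $x$ and leaves at $y$. Put $\alpha=3-2\sqrt2$. **Theorem 4.6.** (i) For all fixed integers $i,j\ge 0$, $$\lim_{n\to\infty}r_{R_n}(p_i,p_j)=|i-j|+\frac{1-\alpha^{|i-j|}}{2\sqrt2},\qquad \lim_{n\to\infty}r_{R_n}(q_i,p_j)=|i-j|+\frac{1+\alpha^{|i-j|}}{2\sqrt2}.$$ In particular, for $j=1$ and $i\ge1$ the limits are $i-1+\frac{1-\alpha^{i-1}}{2\sqrt2}$ and $i-1+\frac{1+\alpha^{i-1}}{2\sqrt2}$.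 (ii) $\displaystyle\lim_{n\to\infty}\frac1n\,r_{R_n}\bigl(p_1,p_{\lfloor (n+2)/2\rfloor}\bigr)=\lim_{n\to\infty}\frac1n\,r_{R_n}\bigl(p_1,q_{\lfloor (n+2)/2\rfloor}\bigr)=\frac14.$ (iii) $\displaystyle\lim_{n\to\infty}\Bigl[r_{R_{n+1}}\bigl(p_1,p_{\lfloor (n+3)/2\rfloor}\bigr)-r_{R_n}\bigl(p_1,p_{\lfloor (n+2)/2\rfloor}\bigr)\Bigr]=\lim_{n\to\infty}\Bigl[r_{R_{n+1}}\bigl(p_1,q_{\lfloor (n+3)/2\rfloor}\bigr)-r_{R_n}\bigl(p_1,q_{\lfloor (n+2)/2\rfloor}\bigr)\Bigr]=\frac14.$ (iv) $\displaystyle\lim_{n\to\infty}r_{R_n}(p_1,p_2)=2-\frac{\sqrt2}2,\qquad \lim_{n\to\infty}r_{R_n}(p_1,q_1)=\frac{\sqrt2}2.$ -/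

import Mathlib

open Filter Topology Matrix

section ResistanceDistance

variable {V : Type*} [Fintype V] [DecidableEq V] (G : SimpleGraph V) [DecidableRel G.Adj]

/-- Every edge of `G` is a resistor of unit resistance.  `φ` is an electric potential for a unit
current entering at `u` and leaving at `v`: by the laws of Ohm and Kirchhoff, the net current
`∑_{y ∼ x} (φ x - φ y)` out of each vertex `x`, which is `(L φ) x` for the graph Laplacian `L`,
is `1` at `u`, `-1` at `v` and `0` elsewhere (and `0` everywhere if `u = v`). -/
def IsUnitCurrentPotential (u v : V) (φ : V → ℝ) : Prop :=
  G.lapMatrix ℝ *ᵥ φ = Pi.single u 1 - Pi.single v 1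

open scoped Classical in
/-- The resistance distance (effective resistance) `r_G(u, v)`: the potential difference between
`u` and `v` when a unit current enters at `u` and leaves at `v`.  (It does not depend on the
potential, and in a connected graph a potential exists, see the two facts below; the value is
`0` by convention if there is no potential.) -/
noncomputable def resistanceDist (u v : V) : ℝ :=
  if h : ∃ φ : V → ℝ, IsUnitCurrentPotential G u v φ then h.choose u - h.choose v else 0

variable {G}

theorem IsUnitCurrentPotential.resistanceDist_eq {u v : V} {φ : V → ℝ}
    (hφ : IsUnitCurrentPotential G u v φ) : resistanceDist G u v = φ u - φ v := by
  have h : ∃ φ : V → ℝ, IsUnitCurrentPotential G u v φ := ⟨φ, hφ⟩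
  have hψ := h.choose_spec
  rw [resistanceDist, dif_pos h]
  generalize h.choose = ψ at hψ
  have key : (G.lapMatrix ℝ *ᵥ φ) ⬝ᵥ ψ = (G.lapMatrix ℝ *ᵥ ψ) ⬝ᵥ φ := by
    rw [dotProduct_comm, dotProduct_mulVec, ← mulVec_transpose, (G.isSymm_lapMatrix ℝ).eq]
  rw [IsUnitCurrentPotential] at hφ hψ
  rw [hφ, hψ] at key
  simpa [sub_dotProduct] using key

theorem exists_isUnitCurrentPotential (hG : G.Connected) (u v : V) :
    ∃ φ : V → ℝ, IsUnitCurrentPotential G u v φ := by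
  have := hG.nonempty
  let L : (V → ℝ) →ₗ[ℝ] (V → ℝ) := (G.lapMatrix ℝ).mulVecLin
  let J : (V → ℝ) →ₗ[ℝ] (V → ℝ) := (Matrix.of fun _ _ : V => (1 : ℝ)).mulVecLin
  have hJ : ∀ φ x, J φ x = ∑ y, φ y := fun φ x => by simp [J, mulVec, dotProduct]
  have hL : ∀ φ, ∑ x, L φ x = 0 := fun φ => by
    have h1 : (fun _ => (1 : ℝ)) ⬝ᵥ (G.lapMatrix ℝ *ᵥ φ) = 0 := by
      rw [dotProduct_mulVec, ← mulVec_transpose, (G.isSymm_lapMatrix ℝ).eq,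
        G.lapMatrix_mulVec_const_eq_zero, zero_dotProduct]
    simpa [dotProduct, L] using h1
  have hcard : (Fintype.card V : ℝ) ≠ 0 := by exact_mod_cast Fintype.card_ne_zero
  have hs : ∀ φ, ∑ x, (L + J) φ x = Fintype.card V * ∑ y, φ y := fun φ => by
    simp [Finset.sum_add_distrib, hL, hJ]
  have hinj : Function.Injective (L + J) := by
    rw [injective_iff_map_eq_zero]
    intro φ hφ
    have h0 : ∑ y, φ y = 0 := by
      have := hs φ
      rw [hφ] at this
      simpa [hcard] using this.symm
    have hLφ : G.lapMatrix ℝ *ᵥ φ = 0 := by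
      ext x
      have := congrFun hφ x
      simpa [hJ, h0, L] using this
    rw [G.lapMatrix_mulVec_eq_zero_iff_forall_reachable] at hLφ
    ext x
    have hc : ∀ y, φ y = φ x := fun y => hLφ y x (hG.preconnected y x)
    simpa [hc, hcard] using h0
  obtain ⟨φ, hφ⟩ := LinearMap.injective_iff_surjective.mp hinj (Pi.single u 1 - Pi.single v 1)
  refine ⟨φ, ?_⟩
  have h0 : ∑ y, φ y = 0 := by
    have := hs φ
    rw [hφ] at this
    simpa [hcard] using this
  ext x
  have := congrFun hφ x
  simpa [hJ, h0, L] using this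

end ResistanceDistance

/-- The four classes of vertices of the hexagonal cylinder chain. -/
inductive HexSite
  | p | u | q | v
  deriving DecidableEq

instance : Fintype HexSite := ⟨{.p, .u, .q, .v}, fun x => by cases x <;> simp⟩

/-- The `4n` vertices `p_k, u_k, q_k, v_k` of the hexagonal cylinder chain with `n` hexagons, the
index `k` being taken modulo `n`. -/
abbrev HexCylVertex (n : ℕ) : Type := HexSite × ZMod n

/-- The edges of the hexagonal cylinder chain: for every `k` modulo `n`, the hexagon
`p_k, u_k, p_{k+1}, q_{k+1}, v_k, q_k`. -/
inductive HexCylEdge (n : ℕ) : HexCylVertex n → HexCylVertex n → Prop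
  | pu (k : ZMod n) : HexCylEdge n (.p, k) (.u, k)
  | up (k : ZMod n) : HexCylEdge n (.u, k) (.p, k + 1)
  | qv (k : ZMod n) : HexCylEdge n (.q, k) (.v, k)
  | vq (k : ZMod n) : HexCylEdge n (.v, k) (.q, k + 1)
  | pq (k : ZMod n) : HexCylEdge n (.p, k) (.q, k)

/-- The linear hexagonal cylinder chain `R_n`: `n` hexagons in a closed ring, consecutive ones
sharing an edge `p_k q_k`. For `n ≥ 2` it has `4n` vertices and
`5n` edges (for `n = 1`, where the ring would have double edges, they are taken once). -/
def hexCylinder (n : ℕ) : SimpleGraph (HexCylVertex n) :=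
  SimpleGraph.fromRel (HexCylEdge n)

noncomputable instance (n : ℕ) : DecidableRel (hexCylinder n).Adj := Classical.decRel _

/-- The vertex `p_i` of `R_n`, the index being read modulo `n` (so that `p_0 = p_n`). -/
def pVertex (n i : ℕ) : HexCylVertex n := (.p, (i : ZMod n))

/-- The vertex `q_i` of `R_n`, the index being read modulo `n` (so that `q_0 = q_n`). -/
def qVertex (n i : ℕ) : HexCylVertex n := (.q, (i : ZMod n))

/-- The constant `α = 3 - 2√2`. -/
noncomputable def hexAlpha : ℝ := 3 - 2 * √2

/-!
Write a potential on the two rails `p`, `q` of the cylinder as the sum of a part that is symmetric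
under exchanging the rails and a part that is antisymmetric. Eliminating the vertices `u_k`, `v_k` of
degree two (where a potential is the average of its neighbours), the Laplacian acts on the two
parts separately, as `f ↦ (2 f_k - f_{k-1} - f_{k+1}) / 2` and as
`g ↦ (2 g_k - g_{k-1} - g_{k+1}) / 2 + 2 g_k` on the cycle `ZMod n`. The first operator has the
quadratic Green function `-k (n - k) / n`, up to the constant source `-1 / n`. Homogeneous solutions
of the second satisfy `g_{k-1} + g_{k+1} = 6 g_k`, whose characteristic roots are `α` and `α⁻¹`; its
Green function is `(α ^ k + α ^ (n - k)) / (2√2 (1 - α ^ n))`.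

Combining them gives the potential of a unit source at any rail vertex (`lap_greenPotential`), and
hence, for `n ≥ 2`, the exact resistance between rail vertices at distance `d` along the cycle
(`resistanceDist_natCast`):
`d (n - d) / n + (1 + α ^ n - ε (α ^ d + α ^ (n - d))) / (2√2 (1 - α ^ n))`,
where `ε = 1` for vertices on the same rail and `ε = -1` otherwise. For fixed `d` the limit is
immediate. For `d = ⌊n / 2⌋` the value is `n / 4 + 1 / (2√2) + o(1)`
(`tendsto_cylinderResistance_half`), which contains both the growth rate and the limit of the
successive differences.
-/

/-! ### The Laplacian of the hexagonal cylinder chain -/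

theorem hexCylinder_adj {n : ℕ} {x y : HexCylVertex n} :
    (hexCylinder n).Adj x y ↔ x ≠ y ∧ (HexCylEdge n x y ∨ HexCylEdge n y x) :=
  SimpleGraph.fromRel_adj _ _ _

theorem hexCylinder_neighborFinset_p {n : ℕ} [NeZero n] (k : ZMod n) :
    (hexCylinder n).neighborFinset (.p, k) = {(.u, k), (.u, k - 1), (.q, k)} := by
  ext y
  simp only [SimpleGraph.mem_neighborFinset, hexCylinder_adj, Finset.mem_insert,
    Finset.mem_singleton]
  constructor
  · rintro ⟨-, h | h⟩ <;> cases h <;> simp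
  · rintro (rfl | rfl | rfl)
    · exact ⟨by simp, .inl (.pu k)⟩
    · exact ⟨by simp, .inr (by have h := HexCylEdge.up (k - 1); rwa [sub_add_cancel] at h)⟩
    · exact ⟨by simp, .inl (.pq k)⟩

theorem hexCylinder_neighborFinset_q {n : ℕ} [NeZero n] (k : ZMod n) :
    (hexCylinder n).neighborFinset (.q, k) = {(.v, k), (.v, k - 1), (.p, k)} := by
  ext y
  simp only [SimpleGraph.mem_neighborFinset, hexCylinder_adj, Finset.mem_insert,
    Finset.mem_singleton]
  constructor
  · rintro ⟨-, h | h⟩ <;> cases h <;> simp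
  · rintro (rfl | rfl | rfl)
    · exact ⟨by simp, .inl (.qv k)⟩
    · exact ⟨by simp, .inr (by have h := HexCylEdge.vq (k - 1); rwa [sub_add_cancel] at h)⟩
    · exact ⟨by simp, .inr (.pq k)⟩

theorem hexCylinder_neighborFinset_u {n : ℕ} [NeZero n] (k : ZMod n) :
    (hexCylinder n).neighborFinset (.u, k) = {(.p, k), (.p, k + 1)} := by
  ext y
  simp only [SimpleGraph.mem_neighborFinset, hexCylinder_adj, Finset.mem_insert,
    Finset.mem_singleton]
  constructor
  · rintro ⟨-, h | h⟩ <;> cases h <;> simp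
  · rintro (rfl | rfl)
    · exact ⟨by simp, .inr (.pu k)⟩
    · exact ⟨by simp, .inl (.up k)⟩

theorem hexCylinder_neighborFinset_v {n : ℕ} [NeZero n] (k : ZMod n) :
    (hexCylinder n).neighborFinset (.v, k) = {(.q, k), (.q, k + 1)} := by
  ext y
  simp only [SimpleGraph.mem_neighborFinset, hexCylinder_adj, Finset.mem_insert,
    Finset.mem_singleton]
  constructor
  · rintro ⟨-, h | h⟩ <;> cases h <;> simp
  · rintro (rfl | rfl)
    · exact ⟨by simp, .inr (.qv k)⟩
    · exact ⟨by simp, .inl (.vq k)⟩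

theorem ZMod.one_ne_zero_of_two_le {n : ℕ} (hn : 2 ≤ n) : (1 : ZMod n) ≠ 0 :=
  have : Fact (1 < n) := ⟨hn⟩
  one_ne_zero

section Laplacian

variable {n : ℕ} [NeZero n] (hn : 2 ≤ n) (φ : HexCylVertex n → ℝ) (k : ZMod n)
include hn

theorem hexCylinder_lap_p : ((hexCylinder n).lapMatrix ℝ *ᵥ φ) (.p, k) =
    3 * φ (.p, k) - φ (.u, k) - φ (.u, k - 1) - φ (.q, k) := by
  have h1 : k ≠ k - 1 := fun h => ZMod.one_ne_zero_of_two_le hn (sub_eq_self.1 h.symm)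
  rw [SimpleGraph.lapMatrix_mulVec_apply, ← SimpleGraph.card_neighborFinset_eq_degree,
    hexCylinder_neighborFinset_p]
  simp [h1]
  ring

theorem hexCylinder_lap_q : ((hexCylinder n).lapMatrix ℝ *ᵥ φ) (.q, k) =
    3 * φ (.q, k) - φ (.v, k) - φ (.v, k - 1) - φ (.p, k) := by
  have h1 : k ≠ k - 1 := fun h => ZMod.one_ne_zero_of_two_le hn (sub_eq_self.1 h.symm)
  rw [SimpleGraph.lapMatrix_mulVec_apply, ← SimpleGraph.card_neighborFinset_eq_degree,
    hexCylinder_neighborFinset_q]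
  simp [h1]
  ring

theorem hexCylinder_lap_u : ((hexCylinder n).lapMatrix ℝ *ᵥ φ) (.u, k) =
    2 * φ (.u, k) - φ (.p, k) - φ (.p, k + 1) := by
  have h1 := ZMod.one_ne_zero_of_two_le hn
  rw [SimpleGraph.lapMatrix_mulVec_apply, ← SimpleGraph.card_neighborFinset_eq_degree,
    hexCylinder_neighborFinset_u]
  simp [h1]
  ring

theorem hexCylinder_lap_v : ((hexCylinder n).lapMatrix ℝ *ᵥ φ) (.v, k) =
    2 * φ (.v, k) - φ (.q, k) - φ (.q, k + 1) := by
  have h1 := ZMod.one_ne_zero_of_two_le hn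
  rw [SimpleGraph.lapMatrix_mulVec_apply, ← SimpleGraph.card_neighborFinset_eq_degree,
    hexCylinder_neighborFinset_v]
  simp [h1]
  ring

end Laplacian

/-! ### Reflection-symmetric functions on the cycle -/

section Cycle

variable {n : ℕ} [NeZero n] {H : ℕ → ℝ} (hH : ∀ k ≤ n, H (n - k) = H k)
include hH

theorem ZMod.apply_val_add_one (j : ZMod n) : H (j + 1).val = H (j.val + 1) := by
  have hj := j.val_lt
  have hcast : j + 1 = ((j.val + 1 : ℕ) : ZMod n) := by simp
  rcases (Nat.succ_le_of_lt hj).lt_or_eq with h | h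
  · rw [hcast, ZMod.val_cast_of_lt h]
  · rw [hcast, show j.val + 1 = n from h, ZMod.natCast_self, ZMod.val_zero]
    simpa using hH n le_rfl

theorem ZMod.apply_val_neg (j : ZMod n) : H (-j).val = H j.val := by
  rw [ZMod.neg_val]
  split_ifs with h
  · simp [h]
  · exact hH _ j.val_lt.le

theorem ZMod.apply_val_natCast_sub (i j : ℕ) (hij : ((i : ℤ) - j).natAbs < n) :
    H ((i : ZMod n) - j).val = H ((i : ℤ) - j).natAbs := by
  rcases le_total j i with h | h
  · obtain ⟨d, rfl⟩ := Nat.exists_eq_add_of_le h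
    have e : (((j + d : ℕ) : ℤ) - j).natAbs = d := by simp
    rw [e] at hij ⊢
    simp [ZMod.val_cast_of_lt hij]
  · obtain ⟨d, rfl⟩ := Nat.exists_eq_add_of_le h
    have e : ((i : ℤ) - (i + d : ℕ)).natAbs = d := by simp
    rw [e] at hij ⊢
    have e' : (i : ZMod n) - (i + d : ℕ) = -(d : ZMod n) := by simp
    rw [e', ZMod.apply_val_neg hH, ZMod.val_cast_of_lt hij]

/-- A reflection-symmetric function on `{0, …, n}` satisfying a second-order recurrence in the
interior descends to the cycle, where the recurrence acquires a source at `0`. -/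
theorem ZMod.recurrence_of_symm {c b e : ℝ} (h0 : c * H 0 - 2 * H 1 = e)
    (hrec : ∀ k, k + 2 ≤ n → c * H (k + 1) - H k - H (k + 2) = b) (j : ZMod n) :
    c * H j.val - H (j - 1).val - H (j + 1).val = if j = 0 then e else b := by
  split_ifs with h
  · subst h
    rw [zero_sub, ZMod.apply_val_neg hH, zero_add, ← zero_add (1 : ZMod n), ZMod.apply_val_add_one hH,
      ← h0, ZMod.val_zero]
    ring
  · obtain ⟨i, rfl⟩ : ∃ i, j = i + 1 := ⟨j - 1, by simp⟩
    have hi : i.val + 1 < n := by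
      refine lt_of_le_of_ne i.val_lt fun hi => h ?_
      have : ((i.val + 1 : ℕ) : ZMod n) = 0 := by rw [hi, ZMod.natCast_self]
      simpa using this
    have e' : (i + 1).val = i.val + 1 := by
      have : i + 1 = ((i.val + 1 : ℕ) : ZMod n) := by simp
      rw [this, ZMod.val_cast_of_lt hi]
    rw [ZMod.apply_val_add_one hH (i + 1), e', add_sub_cancel_right]
    exact hrec _ hi

end Cycle

/-! ### The constant `α` -/

theorem hexAlpha_pos : 0 < hexAlpha := by
  have := Real.sq_sqrt (show (0 : ℝ) ≤ 2 by norm_num)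
  rw [hexAlpha]
  nlinarith [Real.sqrt_nonneg 2]

theorem hexAlpha_lt_one : hexAlpha < 1 := by
  have := Real.one_lt_sqrt_two
  rw [hexAlpha]
  linarith

theorem hexAlpha_sq : hexAlpha ^ 2 = 6 * hexAlpha - 1 := by
  have := Real.sq_sqrt (show (0 : ℝ) ≤ 2 by norm_num)
  rw [hexAlpha]
  linear_combination 4 * this

/-! ### Green functions -/

/-- The symmetric Green function of the two rails, as a function of the distance `k ∈ {0, …, n}`
along the cycle: half its negated second difference is `δ₀ - 1 / n`. -/
noncomputable def symmGreen (n k : ℕ) : ℝ := -(k * (n - k) / n)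

/-- The antisymmetric Green function of the two rails: half its negated second difference, plus
twice the function (the rungs see the potential difference twice), is `δ₀`. -/
noncomputable def antiGreen (n k : ℕ) : ℝ :=
  (hexAlpha ^ k + hexAlpha ^ (n - k)) / (2 * √2 * (1 - hexAlpha ^ n))

theorem symmGreen_sub {n k : ℕ} (hk : k ≤ n) : symmGreen n (n - k) = symmGreen n k := by
  simp only [symmGreen, Nat.cast_sub hk]
  ring

theorem antiGreen_sub {n k : ℕ} (hk : k ≤ n) : antiGreen n (n - k) = antiGreen n k := by
  simp only [antiGreen, Nat.sub_sub_self hk, add_comm]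

theorem symmGreen_recurrence {n : ℕ} [NeZero n] (j : ZMod n) :
    2 * symmGreen n j.val - symmGreen n (j - 1).val - symmGreen n (j + 1).val =
      (if j = 0 then 2 else 0) - 2 / n := by
  have hn : (n : ℝ) ≠ 0 := NeZero.ne _
  rw [ZMod.recurrence_of_symm (fun k hk => symmGreen_sub hk) (c := 2) (b := -2 / n)
    (e := 2 - 2 / n)]
  · split_ifs <;> ring
  · simp only [symmGreen]
    push_cast
    field_simp
    ring
  · intro k _
    simp only [symmGreen]
    push_cast
    field_simp
    ring

theorem antiGreen_recurrence {n : ℕ} [NeZero n] (j : ZMod n) :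
    6 * antiGreen n j.val - antiGreen n (j - 1).val - antiGreen n (j + 1).val =
      if j = 0 then 2 else 0 := by
  have hn : hexAlpha ^ n < 1 :=
    pow_lt_one₀ hexAlpha_pos.le hexAlpha_lt_one (NeZero.ne n)
  have hD : 2 * √2 * (1 - hexAlpha ^ n) ≠ 0 := by
    have : (0 : ℝ) < √2 := by positivity
    have := sub_pos.2 hn
    positivity
  refine ZMod.recurrence_of_symm (fun k hk => antiGreen_sub hk) ?_ ?_ j
  · obtain ⟨m, rfl⟩ := Nat.exists_eq_succ_of_ne_zero (NeZero.ne n)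
    have e : m.succ - 1 = m := rfl
    simp only [antiGreen, e, Nat.sub_zero, pow_zero, pow_one]
    rw [← mul_div_assoc, ← mul_div_assoc, div_sub_div_same, div_eq_iff hD]
    -- `6 - 2α = 4√2`, and `6α - 2 = -4√2 α` because `α² = 6α - 1`
    have hs : √2 = (3 - hexAlpha) / 2 := by rw [hexAlpha]; ring
    rw [hs, Nat.succ_eq_add_one, pow_succ]
    linear_combination (-2 * hexAlpha ^ m) * hexAlpha_sq
  · intro k hk
    obtain ⟨m, rfl⟩ := Nat.exists_eq_add_of_le hk
    have e1 : k + 2 + m - (k + 1) = m + 1 := by omega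
    have e2 : k + 2 + m - k = m + 2 := by omega
    have e3 : k + 2 + m - (k + 2) = m := by omega
    simp only [antiGreen, e1, e2, e3]
    rw [← mul_div_assoc, div_sub_div_same, div_sub_div_same, div_eq_zero_iff]
    left
    linear_combination (-(hexAlpha ^ k + hexAlpha ^ m)) * hexAlpha_sq

/-- The sign that distinguishes the two rails of the cylinder. -/
def railSign : HexSite → ℝ
  | .p => 1
  | .q => -1
  | _ => 0

/-- The potential when a unit current enters at the rail vertex `(s, i)` and leaves in equal parts
`1 / (2n)` at the `2n` vertices `p_k`, `q_k`.  It is averaged at the vertices `u_k`, `v_k` of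
degree two. -/
noncomputable def greenPotential (n : ℕ) (s : HexSite) (i : ZMod n) : HexCylVertex n → ℝ
  | (.p, k) => (symmGreen n (k - i).val + railSign s * antiGreen n (k - i).val) / 2
  | (.q, k) => (symmGreen n (k - i).val - railSign s * antiGreen n (k - i).val) / 2
  | (.u, k) => (symmGreen n (k - i).val + railSign s * antiGreen n (k - i).val +
      (symmGreen n (k + 1 - i).val + railSign s * antiGreen n (k + 1 - i).val)) / 4
  | (.v, k) => (symmGreen n (k - i).val - railSign s * antiGreen n (k - i).val +
      (symmGreen n (k + 1 - i).val - railSign s * antiGreen n (k + 1 - i).val)) / 4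

theorem lap_greenPotential {n : ℕ} [NeZero n] (hn : 2 ≤ n) {s : HexSite} (hs : s = .p ∨ s = .q)
    (i : ZMod n) (x : HexCylVertex n) :
    ((hexCylinder n).lapMatrix ℝ *ᵥ greenPotential n s i) x =
      (Pi.single (s, i) 1 : HexCylVertex n → ℝ) x -
        if x.1 = .p ∨ x.1 = .q then 1 / (2 * n : ℝ) else 0 := by
  obtain ⟨t, k⟩ := x
  have h1 := symmGreen_recurrence (k - i)
  have h2 := antiGreen_recurrence (k - i)
  rw [show k - i - 1 = k - 1 - i by ring, show k - i + 1 = k + 1 - i by ring] at h1 h2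
  simp only [sub_eq_zero] at h1 h2
  have hn0 : (n : ℝ) ≠ 0 := NeZero.ne _
  have hc : 1 / (2 * n : ℝ) = 2 / n / 4 := by field_simp; norm_num
  rw [hc]
  cases t
  · rw [hexCylinder_lap_p hn]
    rcases hs with rfl | rfl <;>
    · simp only [greenPotential, sub_add_cancel, Pi.single_apply, Prod.mk.injEq, railSign]
      split_ifs at * <;> simp_all <;> linarith
  · rw [hexCylinder_lap_u hn]
    rcases hs with rfl | rfl <;>
    · simp [greenPotential]
      ring
  · rw [hexCylinder_lap_q hn]
    rcases hs with rfl | rfl <;>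
    · simp only [greenPotential, sub_add_cancel, Pi.single_apply, Prod.mk.injEq, railSign]
      split_ifs at * <;> simp_all <;> linarith
  · rw [hexCylinder_lap_v hn]
    rcases hs with rfl | rfl <;>
    · simp [greenPotential]
      ring

/-! ### Resistance distances -/

theorem resistanceDist_hexCylinder {n : ℕ} [NeZero n] (hn : 2 ≤ n) {s t : HexSite}
    (hs : s = .p ∨ s = .q) (ht : t = .p ∨ t = .q) (i j : ZMod n) :
    resistanceDist (hexCylinder n) (s, i) (t, j) =
      symmGreen n 0 - symmGreen n (i - j).val +
        (antiGreen n 0 - railSign s * railSign t * antiGreen n (i - j).val) := by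
  have h : IsUnitCurrentPotential (hexCylinder n) (s, i) (t, j)
      (greenPotential n s i - greenPotential n t j) := by
    rw [IsUnitCurrentPotential, Matrix.mulVec_sub]
    ext x
    rw [Pi.sub_apply, Pi.sub_apply, lap_greenPotential hn hs, lap_greenPotential hn ht]
    ring
  rw [h.resistanceDist_eq]
  have hf := ZMod.apply_val_neg (H := symmGreen n) (fun k hk => symmGreen_sub hk) (i - j)
  have hg := ZMod.apply_val_neg (H := antiGreen n) (fun k hk => antiGreen_sub hk) (i - j)
  rw [neg_sub] at hf hg
  rcases hs with rfl | rfl <;> rcases ht with rfl | rfl <;>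
  · simp only [Pi.sub_apply, greenPotential, sub_self, ZMod.val_zero, railSign, hf, hg]
    ring

/-- The resistance distance in `R_n` between two vertices of the rails at distance `d ≤ n` along
the cycle, with `ε = 1` if they lie on the same rail and `ε = -1` otherwise. -/
noncomputable def cylinderResistance (ε : ℝ) (n d : ℕ) : ℝ :=
  d * (n - d) / n +
    (1 + hexAlpha ^ n - ε * (hexAlpha ^ d + hexAlpha ^ (n - d))) /
      (2 * √2 * (1 - hexAlpha ^ n))

theorem resistanceDist_natCast {n : ℕ} [NeZero n] (hn : 2 ≤ n) {s t : HexSite}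
    (hs : s = .p ∨ s = .q) (ht : t = .p ∨ t = .q) {i j : ℕ} (hij : ((i : ℤ) - j).natAbs < n) :
    resistanceDist (hexCylinder n) (s, (i : ZMod n)) (t, (j : ZMod n)) =
      cylinderResistance (railSign s * railSign t) n ((i : ℤ) - j).natAbs := by
  rw [resistanceDist_hexCylinder hn hs ht,
    ZMod.apply_val_natCast_sub (fun k hk => symmGreen_sub hk) i j hij,
    ZMod.apply_val_natCast_sub (fun k hk => antiGreen_sub hk) i j hij]
  simp only [symmGreen, antiGreen, cylinderResistance, Nat.sub_zero, pow_zero, Nat.cast_zero]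
  ring

/-! ### Limits -/

theorem tendsto_hexAlpha_pow : Tendsto (fun n : ℕ => hexAlpha ^ n) atTop (𝓝 0) :=
  tendsto_pow_atTop_nhds_zero_of_lt_one hexAlpha_pos.le hexAlpha_lt_one

theorem tendsto_cylinderResistance_fixed (ε : ℝ) (d : ℕ) :
    Tendsto (fun n => cylinderResistance ε n d) atTop
      (𝓝 (d + (1 - ε * hexAlpha ^ d) / (2 * √2))) := by
  have h1 := tendsto_hexAlpha_pow
  have h2 : Tendsto (fun n : ℕ => hexAlpha ^ (n - d)) atTop (𝓝 0) :=
    h1.comp (tendsto_sub_atTop_nat d)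
  have h3 : Tendsto (fun n : ℕ => (d : ℝ) - (d : ℝ) ^ 2 / n) atTop (𝓝 (d - 0)) :=
    tendsto_const_nhds.sub (tendsto_const_div_atTop_nhds_zero_nat _)
  have h4 := h3.add ((((h1.const_add 1).sub ((h2.const_add (hexAlpha ^ d)).const_mul ε)).div
    ((h1.const_sub 1).const_mul (2 * √2)) (by simp)))
  simp only [add_zero, sub_zero, mul_one] at h4
  refine h4.congr' ?_
  filter_upwards [eventually_ne_atTop 0] with n hn
  have : (n : ℝ) ≠ 0 := by exact_mod_cast hn
  rw [cylinderResistance]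
  congr 1
  field_simp

/-- The antipodal resistance is `n / 4 + 1 / (2√2) + o(1)` for both signs `ε`. -/
theorem tendsto_cylinderResistance_half (ε : ℝ) :
    Tendsto (fun n : ℕ => cylinderResistance ε n (n / 2) - n / 4) atTop (𝓝 (1 / (2 * √2))) := by
  have h1 := tendsto_hexAlpha_pow
  have hd : Tendsto (fun n : ℕ => n / 2) atTop atTop := Nat.tendsto_div_const_atTop two_ne_zero
  have hd' : Tendsto (fun n : ℕ => n - n / 2) atTop atTop :=
    tendsto_atTop_mono (fun n => by omega) hd
  have h0 : Tendsto (fun n : ℕ => -((n % 2 : ℕ) : ℝ) / 4 / n) atTop (𝓝 0) := by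
    refine squeeze_zero_norm (fun n => ?_) (tendsto_const_div_atTop_nhds_zero_nat 1)
    rw [norm_div, Real.norm_natCast]
    gcongr
    have : ((n % 2 : ℕ) : ℝ) ≤ 1 := by exact_mod_cast Nat.le_of_lt_succ (Nat.mod_lt n two_pos)
    rw [Real.norm_eq_abs, abs_le]
    constructor <;> linarith [Nat.cast_nonneg (α := ℝ) (n % 2)]
  have h4 := h0.add ((((h1.const_add 1).sub
    (((h1.comp hd).add (h1.comp hd')).const_mul ε)).div
    ((h1.const_sub 1).const_mul (2 * √2)) (by simp)))
  simp only [add_zero, sub_zero, mul_one, mul_zero, zero_add] at h4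
  refine h4.congr' ?_
  filter_upwards [eventually_ne_atTop 0] with n hn
  have hn' : (n : ℝ) ≠ 0 := by exact_mod_cast hn
  simp only [cylinderResistance, Function.comp_apply]
  rw [add_sub_right_comm]
  congr 1
  -- with `r = n % 2`, the linear part is `(n² - r²) / (4n)`, and `r² = r`
  have hr : (n : ℝ) = 2 * (n / 2 : ℕ) + (n % 2 : ℕ) := by exact_mod_cast (Nat.div_add_mod n 2).symm
  have hr2 : ((n % 2 : ℕ) : ℝ) ^ 2 = (n % 2 : ℕ) := by
    rcases Nat.mod_two_eq_zero_or_one n with h | h <;> simp [h]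
  have hd : ((n / 2 : ℕ) : ℝ) = (n - (n % 2 : ℕ)) / 2 := by linarith
  rw [hd]
  field_simp
  linear_combination 4 * hr2

theorem tendsto_resistanceDist_fixed {s t : HexSite} (hs : s = .p ∨ s = .q)
    (ht : t = .p ∨ t = .q) (i j : ℕ) :
    Tendsto (fun n : ℕ+ => resistanceDist (hexCylinder n) (s, (i : ZMod n)) (t, (j : ZMod n)))
      atTop (𝓝 (|(i : ℝ) - j| +
        (1 - railSign s * railSign t * hexAlpha ^ ((i : ℤ) - j).natAbs) / (2 * √2))) := by
  have h := (tendsto_cylinderResistance_fixed (railSign s * railSign t)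
    ((i : ℤ) - j).natAbs).comp tendsto_PNat_val_atTop_atTop
  have e : ((((i : ℤ) - j).natAbs : ℕ) : ℝ) = |(i : ℝ) - j| := by
    rw [Nat.cast_natAbs]; push_cast; rfl
  rw [e] at h
  refine h.congr' ?_
  filter_upwards [tendsto_PNat_val_atTop_atTop.eventually_ge_atTop 2,
    tendsto_PNat_val_atTop_atTop.eventually_gt_atTop ((i : ℤ) - j).natAbs] with n h2 hd
  exact (resistanceDist_natCast h2 hs ht hd).symm

theorem resistanceDist_antipodal {n : ℕ} [NeZero n] (hn : 2 ≤ n) {t : HexSite}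
    (ht : t = .p ∨ t = .q) :
    resistanceDist (hexCylinder n) (pVertex n 1) (t, (((n + 2) / 2 : ℕ) : ZMod n)) =
      cylinderResistance (railSign t) n (n / 2) := by
  have e : (((1 : ℕ) : ℤ) - ((n + 2) / 2 : ℕ)).natAbs = n / 2 := by omega
  have h := resistanceDist_natCast hn (.inl rfl) ht (i := 1) (j := (n + 2) / 2)
    (by rw [e]; omega)
  rw [e] at h
  simpa [railSign, pVertex] using h

theorem tendsto_resistanceDist_antipodal {t : HexSite} (ht : t = .p ∨ t = .q) :
    Tendsto (fun n : ℕ+ => resistanceDist (hexCylinder n) (pVertex n 1)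
      (t, ((((n : ℕ) + 2) / 2 : ℕ) : ZMod n)) - (n : ℝ) / 4) atTop (𝓝 (1 / (2 * √2))) := by
  refine ((tendsto_cylinderResistance_half (railSign t)).comp
    tendsto_PNat_val_atTop_atTop).congr' ?_
  filter_upwards [tendsto_PNat_val_atTop_atTop.eventually_ge_atTop 2] with n h2
  exact congrArg (· - (n : ℝ) / 4) (resistanceDist_antipodal h2 ht).symm

theorem tendsto_inv_mul_resistanceDist_antipodal {t : HexSite} (ht : t = .p ∨ t = .q) :
    Tendsto (fun n : ℕ+ => 1 / (n : ℝ) * resistanceDist (hexCylinder n) (pVertex n 1)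
      (t, ((((n : ℕ) + 2) / 2 : ℕ) : ZMod n))) atTop (𝓝 (1 / 4)) := by
  have h0 : Tendsto (fun n : ℕ+ => 1 / (n : ℝ)) atTop (𝓝 0) :=
    tendsto_one_div_atTop_nhds_zero_nat.comp tendsto_PNat_val_atTop_atTop
  have h := (h0.mul (tendsto_resistanceDist_antipodal ht)).add_const (1 / 4)
  rw [zero_mul, zero_add] at h
  refine h.congr fun n => ?_
  have : (n : ℝ) ≠ 0 := by exact_mod_cast n.ne_zero
  field_simp
  ring

theorem tendsto_resistanceDist_antipodal_succ_sub {t : HexSite} (ht : t = .p ∨ t = .q) :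
    Tendsto (fun n : ℕ+ =>
      resistanceDist (hexCylinder (n + 1 : ℕ+)) (pVertex (n + 1 : ℕ+) 1)
          (t, ((((n : ℕ) + 3) / 2 : ℕ) : ZMod (n + 1 : ℕ+))) -
        resistanceDist (hexCylinder n) (pVertex n 1) (t, ((((n : ℕ) + 2) / 2 : ℕ) : ZMod n)))
      atTop (𝓝 (1 / 4)) := by
  have hsucc : Tendsto (fun n : ℕ+ => n + 1) atTop atTop :=
    tendsto_atTop_mono (fun n => (PNat.lt_add_right n 1).le) tendsto_id
  have h := (tendsto_resistanceDist_antipodal ht).comp hsucc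
  have h' := (h.sub (tendsto_resistanceDist_antipodal ht)).add_const (1 / 4)
  rw [sub_self, zero_add] at h'
  refine h'.congr fun n => ?_
  have e : ((n + 1 : ℕ+) : ℕ) + 2 = n + 3 := by rw [PNat.add_coe, PNat.one_coe]
  have e' : (((n + 1 : ℕ+) : ℕ) : ℝ) = n + 1 := by rw [PNat.add_coe, PNat.one_coe]; push_cast; rfl
  simp only [Function.comp_apply, e, e']
  ring

theorem theorem4p6 :
    -- (i) resistances between fixed vertices
    (∀ i j : ℕ,
      Tendsto (fun n : ℕ+ => resistanceDist (hexCylinder n) (pVertex n i) (pVertex n j)) atTop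
          (𝓝 (|(i : ℝ) - j| + (1 - hexAlpha ^ ((i : ℤ) - j).natAbs) / (2 * √2))) ∧
      Tendsto (fun n : ℕ+ => resistanceDist (hexCylinder n) (qVertex n i) (pVertex n j)) atTop
          (𝓝 (|(i : ℝ) - j| + (1 + hexAlpha ^ ((i : ℤ) - j).natAbs) / (2 * √2)))) ∧
    -- (ii) growth of the antipodal resistances
    (Tendsto (fun n : ℕ+ =>
        1 / (n : ℝ) *
          resistanceDist (hexCylinder n) (pVertex n 1) (pVertex n (((n : ℕ) + 2) / 2))) atTop
        (𝓝 (1 / 4)) ∧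
      Tendsto (fun n : ℕ+ =>
        1 / (n : ℝ) *
          resistanceDist (hexCylinder n) (pVertex n 1) (qVertex n (((n : ℕ) + 2) / 2))) atTop
        (𝓝 (1 / 4))) ∧
    -- (iii) successive differences of the antipodal resistances
    (Tendsto (fun n : ℕ+ =>
        resistanceDist (hexCylinder (n + 1 : ℕ+)) (pVertex (n + 1 : ℕ+) 1)
            (pVertex (n + 1 : ℕ+) (((n : ℕ) + 3) / 2)) -
          resistanceDist (hexCylinder n) (pVertex n 1) (pVertex n (((n : ℕ) + 2) / 2))) atTop
        (𝓝 (1 / 4)) ∧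
      Tendsto (fun n : ℕ+ =>
        resistanceDist (hexCylinder (n + 1 : ℕ+)) (pVertex (n + 1 : ℕ+) 1)
            (qVertex (n + 1 : ℕ+) (((n : ℕ) + 3) / 2)) -
          resistanceDist (hexCylinder n) (pVertex n 1) (qVertex n (((n : ℕ) + 2) / 2))) atTop
        (𝓝 (1 / 4))) ∧
    -- (iv) resistances of two particular pairs
    (Tendsto (fun n : ℕ+ => resistanceDist (hexCylinder n) (pVertex n 1) (pVertex n 2)) atTop
        (𝓝 (2 - √2 / 2)) ∧
      Tendsto (fun n : ℕ+ => resistanceDist (hexCylinder n) (pVertex n 1) (qVertex n 1)) atTop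
        (𝓝 (√2 / 2))) := by
  have hp : HexSite.p = .p ∨ HexSite.p = .q := .inl rfl
  have hq : HexSite.q = .p ∨ HexSite.q = .q := .inr rfl
  have h2 : (√2 : ℝ) ^ 2 = 2 := Real.sq_sqrt (by norm_num)
  refine ⟨fun i j => ⟨?_, ?_⟩,
    ⟨tendsto_inv_mul_resistanceDist_antipodal hp, tendsto_inv_mul_resistanceDist_antipodal hq⟩,
    ⟨tendsto_resistanceDist_antipodal_succ_sub hp,
      tendsto_resistanceDist_antipodal_succ_sub hq⟩, ?_, ?_⟩
  · simpa [railSign, pVertex] using tendsto_resistanceDist_fixed hp hp i j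
  · simpa [railSign, pVertex, qVertex] using tendsto_resistanceDist_fixed hq hp i j
  · have h := tendsto_resistanceDist_fixed hp hp 1 2
    have e : |((1 : ℕ) : ℝ) - (2 : ℕ)| + (1 - railSign .p * railSign .p *
        hexAlpha ^ (((1 : ℕ) : ℤ) - (2 : ℕ)).natAbs) / (2 * √2) = 2 - √2 / 2 := by
      norm_num [railSign, hexAlpha]
      field_simp
      linear_combination (1 : ℝ) * h2
    rwa [e] at h
  · have h := tendsto_resistanceDist_fixed hp hq 1 1
    have e : |((1 : ℕ) : ℝ) - (1 : ℕ)| + (1 - railSign .p * railSign .q *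
        hexAlpha ^ (((1 : ℕ) : ℤ) - (1 : ℕ)).natAbs) / (2 * √2) = √2 / 2 := by
      norm_num [railSign]
      rw [div_eq_div_iff (by positivity) two_ne_zero]
      linear_combination (-2 : ℝ) * h2
    rwa [e] at h
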